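/- Let $d\ge 0$ and let $P\subset\mathbb R^d$ be a polytope, that is, a compact convex set with non-empty interior which is the intersection of finitely many closed half-spaces. For $r\ge 0$ let $P(r)=\{x\in P:\ \|x-y\|\ge r \text{ for all } y\in\partial P\}$ and let $V_P(r)=\mathrm{vol}_d(P\setminus P(r))$. Then: (1) $V_P:[0,\infty)\to[0,\infty)$ is a degree $d$ pluri-phase Steiner-like function: it is continuous, and there are numbers $0=g_0<g_1<\dots<g_n$ (with $n\ge 0$) such that on each interval $[g_{i-1},g_i]$, $1\le i\le n$, $V_P$ is given by a polynomial $\sum_{j=0}^d c_{i,j}r^j$ of degree at most $d$, and $V_P$ is constant on $[g_n,\infty)$. (2) Let $\{x:\langle N_j,x\rangle\ge b_j\}$, $1\le j\le m$, with $\|N_j\|=1$, be a minimal collection of closed half-spaces whose intersection is $P$, so that $N_1,\dots,N_m$ are the inner unit normal vectors of the facets of $P$. Suppose that the family $(N_1,\dots,N_m)$ has absolute rank $k$, meaning that any $k$ of its members are linearly independent and some $k+1$ of its members are linearly dependent (the empty family, which occurs only for $d=0$, has absolute rank $0$). Then $V_P$ is of class $C^{\max(k-1,0)}$ on $[0,\infty)$,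 with one-sided derivatives at $0$. (For $d\ge 1$ one has $k\ge 1$, so the class is $C^{k-1}$.) -/

import Mathlib

open MeasureTheory Set

/-- The closed half-space `{x | b ≤ ⟪N, x⟫}` of `ℝ^d` with inner normal vector `N`. -/
def closedHalfSpace {d : ℕ} (N : EuclideanSpace ℝ (Fin d)) (b : ℝ) :
    Set (EuclideanSpace ℝ (Fin d)) :=
  {x | b ≤ inner ℝ N x}

/-- A polytope in `ℝ^d`: a convex body (compact, convex, with nonempty interior) that is the
intersection of finitely many closed half-spaces. -/
structure IsPolytope {d : ℕ} (P : Set (EuclideanSpace ℝ (Fin d))) : Prop where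
  isCompact : IsCompact P
  convex : Convex ℝ P
  interior_nonempty : (interior P).Nonempty
  exists_halfSpaces : ∃ (m : ℕ) (N : Fin m → EuclideanSpace ℝ (Fin d)) (b : Fin m → ℝ),
    (∀ j, ‖N j‖ = 1) ∧ P = ⋂ j, closedHalfSpace (N j) (b j)

/-- The half-spaces `closedHalfSpace (N j) (b j)`, with unit normal vectors `N j`, form a minimal
collection of half-spaces whose intersection is `P`. For a polytope `P` these are the half-spaces
that contain `P` and are bounded by the hyperplanes supporting its facets, and `N` is the family
of the inner unit normal vectors of the facets of `P`. -/
structure IsMinimalHalfSpaceFamily {d m : ℕ} (P : Set (EuclideanSpace ℝ (Fin d)))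
    (N : Fin m → EuclideanSpace ℝ (Fin d)) (b : Fin m → ℝ) : Prop where
  norm_eq_one : ∀ j, ‖N j‖ = 1
  eq_iInter : P = ⋂ j, closedHalfSpace (N j) (b j)
  minimal : ∀ s : Set (Fin m), P = ⋂ j ∈ s, closedHalfSpace (N j) (b j) → s = univ

/-- A finite family of vectors has absolute rank `k` if any `k` of its members are linearly
independent and some `k + 1` of its members are linearly dependent; by convention the empty
family has absolute rank `0`. -/
def HasAbsoluteRank {d m : ℕ} (N : Fin m → EuclideanSpace ℝ (Fin d)) (k : ℕ) : Prop :=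
  (m = 0 ∧ k = 0) ∨
    ((∀ s : Finset (Fin m), s.card = k → LinearIndepOn ℝ N (s : Set (Fin m))) ∧
      ∃ s : Finset (Fin m), s.card = k + 1 ∧ ¬ LinearIndepOn ℝ N (s : Set (Fin m)))

/-- The `r`-interior of `P`: the points of `P` at distance at least `r` from the boundary of `P`
(if the boundary is empty, the condition on the distance is void). -/
def rInterior {d : ℕ} (P : Set (EuclideanSpace ℝ (Fin d))) (r : ℝ) :
    Set (EuclideanSpace ℝ (Fin d)) :=
  {x ∈ P | ∀ y ∈ frontier P, r ≤ dist x y}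

/-- The inner neighborhood volume function `V_P(r) = vol_d (P \ P(r))`. -/
noncomputable def innerVolume {d : ℕ} (P : Set (EuclideanSpace ℝ (Fin d))) (r : ℝ) : ℝ :=
  (volume (P \ rInterior P r)).toReal

/-- Degree `d` pluri-phase Steiner-like functions `φ : [0, ∞) → [0, ∞)`: continuous, given by a
polynomial of degree at most `d` on each interval `[g i, g (i + 1)]`, where
`0 = g 0 < ⋯ < g n`, and constant on `[g n, ∞)`. Only the values on `[0, ∞)` matter. -/
def IsPluriphaseSteinerLike (d : ℕ) (φ : ℝ → ℝ) : Prop :=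
  ContinuousOn φ (Ici 0) ∧ (∀ r ∈ Ici (0 : ℝ), 0 ≤ φ r) ∧
    ∃ (n : ℕ) (g : Fin (n + 1) → ℝ), g 0 = 0 ∧ StrictMono g ∧
      (∀ i : Fin n, ∃ p : Polynomial ℝ, p.natDegree ≤ d ∧
        ∀ r ∈ Icc (g i.castSucc) (g i.succ), φ r = p.eval r) ∧
      ∃ c : ℝ, ∀ r ∈ Ici (g (Fin.last n)), φ r = c

/-! For `r ≥ 0` the inner parallel body `P(r)` is obtained by raising every support number `b j` by
`r` (`rInterior_eq_polyhedron`). So `V_P(r)` is the volume of `P` minus the volume of a polyhedron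
with support numbers `b j + r`, and both claims concern volumes of polyhedra.

Piecewise polynomiality: the indicator of the polyhedron is a piecewise constant function of `(r,
y)` jointly, with pieces cut out by affine functions. Integrating out one coordinate of `y` over a
bounded interval raises the degree by at most one (`IsPiecewisePoly.integral_pow_mul`), so `d`
integrations leave a piecewise polynomial of degree at most `d` in `r`. It is polynomial off a
finite set, and continuity of the volume joins the pieces. For large `r` the volume is constant.

Smoothness: let all support numbers vary independently. The partial derivative of the volume in `t
j` is a constant times the volume of the `j`-th facet, itself a polyhedron in the hyperplane `(L
j).ker` whose support numbers are linear in `t`. Restriction to this hyperplane costs one degree of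
independence of the normals, so induction (`contDiff_measureReal_polyhedron`) gives one derivative
per degree, down to mere continuity when all functionals are nonzero. -/

/-- Functions that are polynomial of total degree at most `n` on each cell of a finite arrangement of
affine hyperplanes, generated by constants, sums, products with affine functions, and restriction
to open affine half-spaces. -/
inductive IsPiecewisePoly {E : Type*} [AddCommGroup E] [Module ℝ E] : ℕ → (E → ℝ) → Prop
  | const (c : ℝ) : IsPiecewisePoly 0 (fun _ => c)
  | succ {n : ℕ} {f : E → ℝ} : IsPiecewisePoly n f → IsPiecewisePoly (n + 1) f
  | add {n : ℕ} {f g : E → ℝ} : IsPiecewisePoly n f → IsPiecewisePoly n g →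
      IsPiecewisePoly n (fun x => f x + g x)
  | affine_mul {n : ℕ} {f : E → ℝ} (l : E →ᵃ[ℝ] ℝ) : IsPiecewisePoly n f →
      IsPiecewisePoly (n + 1) (fun x => l x * f x)
  | cut {n : ℕ} {f : E → ℝ} (l : E →ᵃ[ℝ] ℝ) : IsPiecewisePoly n f →
      IsPiecewisePoly n (fun x => if 0 < l x then f x else 0)

/-! ### Piecewise polynomial functions and their integrals -/

namespace IsPiecewisePoly

section Algebra

variable {E E' : Type*} [AddCommGroup E] [Module ℝ E] [AddCommGroup E'] [Module ℝ E']

theorem const_mul {n : ℕ} {f : E → ℝ} (hf : IsPiecewisePoly n f) (c : ℝ) :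
    IsPiecewisePoly n (fun x => c * f x) := by
  induction hf with
  | const a => exact const (c * a)
  | succ _ ih => exact ih.succ
  | add _ _ ih₁ ih₂ => simpa only [mul_add] using ih₁.add ih₂
  | affine_mul l _ ih => simpa only [mul_left_comm] using ih.affine_mul l
  | cut l _ ih => simpa only [mul_ite, mul_zero] using ih.cut l

theorem sub {n : ℕ} {f g : E → ℝ} (hf : IsPiecewisePoly n f) (hg : IsPiecewisePoly n g) :
    IsPiecewisePoly n (fun x => f x - g x) := by
  simpa [sub_eq_add_neg] using hf.add (hg.const_mul (-1))

theorem congr {n : ℕ} {f g : E → ℝ} (hf : IsPiecewisePoly n f) (h : ∀ x, f x = g x) :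
    IsPiecewisePoly n g :=
  funext h ▸ hf

theorem mono {n m : ℕ} {f : E → ℝ} (hf : IsPiecewisePoly n f) (h : n ≤ m) :
    IsPiecewisePoly m f := by
  induction m, h using Nat.le_induction with
  | base => exact hf
  | succ _ _ ih => exact ih.succ

theorem comp_affine {n : ℕ} {f : E → ℝ} (hf : IsPiecewisePoly n f) (A : E' →ᵃ[ℝ] E) :
    IsPiecewisePoly n (fun x => f (A x)) := by
  induction hf with
  | const a => exact const a
  | succ _ ih => exact ih.succ
  | add _ _ ih₁ ih₂ => exact ih₁.add ih₂
  | affine_mul l _ ih => exact ih.affine_mul (l.comp A)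
  | cut l _ ih => exact ih.cut (l.comp A)

theorem ite_lt {n : ℕ} {f g : E → ℝ} (hf : IsPiecewisePoly n f) (hg : IsPiecewisePoly n g)
    (l : E →ᵃ[ℝ] ℝ) : IsPiecewisePoly n (fun x => if 0 < l x then f x else g x) := by
  convert (hf.cut l).add (hg.sub (hg.cut l)) using 2 with x
  split_ifs <;> simp

theorem cut_le {n : ℕ} {f : E → ℝ} (hf : IsPiecewisePoly n f) (l : E →ᵃ[ℝ] ℝ) :
    IsPiecewisePoly n (fun x => if 0 ≤ l x then f x else 0) := by
  -- A closed half-space is the complement of the open half-space `0 < -l`.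
  convert ((const 0).mono (Nat.zero_le n)).ite_lt hf (-l) using 2 with x
  by_cases h : 0 ≤ l x
  · simp [h]
  · simp [h, not_le.1 h]

theorem affine_pow_mul {n : ℕ} {f : E → ℝ} (hf : IsPiecewisePoly n f) (l : E →ᵃ[ℝ] ℝ) (j : ℕ) :
    IsPiecewisePoly (n + j) (fun x => l x ^ j * f x) := by
  induction j with
  | zero => simpa using hf
  | succ j ih => simpa only [pow_succ', mul_assoc, ← add_assoc] using ih.affine_mul l

theorem indicator_of_forall {m : ℕ} (l : Fin m → E →ᵃ[ℝ] ℝ) :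
    IsPiecewisePoly 0 ({x | ∀ i, 0 ≤ l i x}.indicator fun _ => (1 : ℝ)) := by
  induction m with
  | zero => simpa using const (E := E) 1
  | succ m ih =>
    convert (ih fun i => l i.succ).cut_le (l 0) using 2 with x
    simp only [indicator, mem_ofPred_eq, Fin.forall_fin_succ]
    split_ifs <;> simp_all

end Algebra

section Regularity

variable {E : Type*} [NormedAddCommGroup E] [NormedSpace ℝ E] [FiniteDimensional ℝ E]

theorem measurable [MeasurableSpace E] [BorelSpace E] {n : ℕ} {f : E → ℝ}
    (hf : IsPiecewisePoly n f) : Measurable f := by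
  induction hf with
  | const a => exact measurable_const
  | succ _ ih => exact ih
  | add _ _ ih₁ ih₂ => exact ih₁.add ih₂
  | affine_mul l _ ih => exact l.continuous_of_finiteDimensional.measurable.mul ih
  | cut l _ ih =>
    exact Measurable.ite (measurableSet_lt measurable_const
      l.continuous_of_finiteDimensional.measurable) ih measurable_const

theorem exists_bound {n : ℕ} {f : E → ℝ} (hf : IsPiecewisePoly n f) {K : Set E}
    (hK : IsCompact K) : ∃ C, 0 ≤ C ∧ ∀ x ∈ K, ‖f x‖ ≤ C := by
  induction hf with
  | const a => exact ⟨‖a‖, norm_nonneg a, fun _ _ => le_rfl⟩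
  | succ _ ih => exact ih
  | add _ _ ih₁ ih₂ =>
    obtain ⟨C₁, h₁, hC₁⟩ := ih₁
    obtain ⟨C₂, h₂, hC₂⟩ := ih₂
    exact ⟨C₁ + C₂, by positivity, fun x hx => norm_add_le_of_le (hC₁ x hx) (hC₂ x hx)⟩
  | affine_mul l _ ih =>
    obtain ⟨C, h, hC⟩ := ih
    obtain ⟨D, hD⟩ := hK.exists_bound_of_continuousOn l.continuous_of_finiteDimensional.continuousOn
    refine ⟨|D| * C, by positivity, fun x hx => ?_⟩
    rw [norm_mul]
    exact mul_le_mul ((hD x hx).trans (le_abs_self D)) (hC x hx) (norm_nonneg _) (abs_nonneg D)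
  | cut l _ ih =>
    obtain ⟨C, h, hC⟩ := ih
    refine ⟨C, h, fun x hx => ?_⟩
    dsimp only
    split_ifs
    · exact hC x hx
    · simpa using h

theorem integrableOn [MeasurableSpace E] [BorelSpace E] {n : ℕ} {f : E → ℝ}
    (hf : IsPiecewisePoly n f) {K : Set E} (hK : IsCompact K) (μ : Measure E)
    [IsFiniteMeasureOnCompacts μ] : IntegrableOn f K μ := by
  obtain ⟨C, -, hC⟩ := hf.exists_bound hK
  exact Measure.integrableOn_of_bounded hK.measure_lt_top.ne hf.measurable.aestronglyMeasurable
    ((ae_restrict_iff' hK.measurableSet).2 (Filter.Eventually.of_forall hC))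

theorem intervalIntegrable {n : ℕ} {f : ℝ → ℝ} (hf : IsPiecewisePoly n f) (a b : ℝ) :
    IntervalIntegrable f volume a b :=
  (hf.integrableOn isCompact_uIcc volume).intervalIntegrable

end Regularity

theorem intervalIntegral_ite_lt (f : ℝ → ℝ) (a b s : ℝ) :
    ∫ y in a..b, (if s < y then f y else 0) = ∫ y in max a s..max b s, f y := by
  have key : ∀ a b, a ≤ b →
      ∫ y in a..b, (if s < y then f y else 0) = ∫ y in max a s..max b s, f y := by
    intro a b hab
    rw [intervalIntegral.integral_of_le hab,
      intervalIntegral.integral_of_le (max_le_max_right s hab)]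
    have : (fun y => if s < y then f y else 0) = (Ioi s).indicator f := by
      ext y; simp [indicator]
    rw [this, setIntegral_indicator measurableSet_Ioi]
    congr 2
    ext y
    simp only [mem_inter_iff, mem_Ioc, mem_Ioi, max_lt_iff, le_max_iff]
    constructor
    · rintro ⟨⟨h₁, h₂⟩, h₃⟩; exact ⟨⟨h₁, h₃⟩, Or.inl h₂⟩
    · rintro ⟨⟨h₁, h₃⟩, h₂ | h₂⟩
      · exact ⟨⟨h₁, h₂⟩, h₃⟩
      · exact absurd h₃ (not_lt.2 h₂)
  rcases le_total a b with h | h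
  · exact key a b h
  · rw [intervalIntegral.integral_symm, key b a h, ← intervalIntegral.integral_symm]

section Integral

variable {E : Type*} [AddCommGroup E] [Module ℝ E]

theorem comp_prodMk {n : ℕ} {f : E × ℝ → ℝ} (hf : IsPiecewisePoly n f) (x : E) :
    IsPiecewisePoly n (fun y => f (x, y)) :=
  hf.comp_affine ((AffineMap.const ℝ ℝ x).prod (AffineMap.id ℝ ℝ))

theorem pow_mul_comp_prodMk {n : ℕ} {f : E × ℝ → ℝ} (hf : IsPiecewisePoly n f) (x : E) (j : ℕ) :
    IsPiecewisePoly (n + j) (fun y => y ^ j * f (x, y)) :=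
  (hf.comp_prodMk x).affine_pow_mul (AffineMap.id ℝ ℝ) j

theorem _root_.AffineMap.prod_apply_eq (l : E × ℝ →ᵃ[ℝ] ℝ) (x : E) (y : ℝ) :
    l (x, y) = l (x, 0) + y * l.linear (0, 1) := by
  have := l.map_vadd (x, 0) (y • ((0 : E), (1 : ℝ)))
  rw [map_smul] at this
  simpa [add_comm] using this

/-- The weight `y ^ j` makes the induction close: an affine factor splits as `l (x, 0) + y * c`, and
the second summand raises `j`. The variable upper limit serves the cuts: when `c ≠ 0` a cut happens
at a point `s` that is affine in `x`, so the integral is a difference of primitives evaluated at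
`max`es of affine functions. -/
theorem integral_pow_mul {n : ℕ} {f : E × ℝ → ℝ} (hf : IsPiecewisePoly n f) (j : ℕ) :
    IsPiecewisePoly (n + j + 1) (fun p : E × ℝ => ∫ y in 0..p.2, y ^ j * f (p.1, y)) := by
  let snd : E × ℝ →ᵃ[ℝ] ℝ := (LinearMap.snd ℝ E ℝ).toAffineMap
  let base : E × ℝ →ᵃ[ℝ] E × ℝ :=
    ((LinearMap.inl ℝ E ℝ).comp (LinearMap.fst ℝ E ℝ)).toAffineMap
  induction hf generalizing j with
  | const a =>
    refine (((const (E := E × ℝ) (a / (j + 1))).affine_pow_mul snd (j + 1)).mono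
      (by omega)).congr fun p => ?_
    simp [snd]
    ring
  | succ _ ih => exact (ih j).succ.mono (by omega)
  | @add n f g hf hg ih₁ ih₂ =>
    convert (ih₁ j).add (ih₂ j) using 2 with p
    rw [← intervalIntegral.integral_add]
    · simp only [mul_add]
    · exact (hf.pow_mul_comp_prodMk p.1 j).intervalIntegrable _ _
    · exact (hg.pow_mul_comp_prodMk p.1 j).intervalIntegrable _ _
  | @affine_mul n f l hf ih =>
    have h₁ := (ih j).affine_mul (l.comp base)
    have h₂ := (ih (j + 1)).const_mul (l.linear (0, 1))
    convert (h₁.mono (by omega)).add (h₂.mono (by omega : _ ≤ n + 1 + j + 1)) using 2 with p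
    rw [← intervalIntegral.integral_const_mul, ← intervalIntegral.integral_const_mul,
      ← intervalIntegral.integral_add]
    · refine intervalIntegral.integral_congr fun y _ => ?_
      simp only [AffineMap.prod_apply_eq l p.1 y]
      simp [base]
      ring
    · exact ((hf.pow_mul_comp_prodMk p.1 j).intervalIntegrable _ _).const_mul _
    · exact ((hf.pow_mul_comp_prodMk p.1 (j + 1)).intervalIntegrable _ _).const_mul _
  | @cut n f l hf ih =>
    have hint : ∀ (x : E) (a b : ℝ), IntervalIntegrable (fun y => y ^ j * f (x, y)) volume a b :=
      fun x a b => (hf.pow_mul_comp_prodMk x j).intervalIntegrable a b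
    let c : ℝ := l.linear (0, 1)
    rcases eq_or_ne c 0 with hc | hc
    · refine ((ih j).cut (l.comp base)).congr fun p => ?_
      have : ∀ y, l (p.1, y) = l (p.1, 0) := fun y => by
        rw [AffineMap.prod_apply_eq, show l.linear (0, 1) = 0 from hc, mul_zero, add_zero]
      have hb : (l.comp base) p = l (p.1, 0) := rfl
      by_cases h : 0 < l (p.1, 0) <;> simp [this, hb, h]
    · let s : E × ℝ →ᵃ[ℝ] ℝ := (-c⁻¹) • l.comp base
      have hs : ∀ p : E × ℝ, s p = -c⁻¹ * l (p.1, 0) := fun p => by simp [s, base]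
      let fst : E × ℝ →ᵃ[ℝ] E := (LinearMap.fst ℝ E ℝ).toAffineMap
      let J : E × ℝ → ℝ := fun p => ∫ y in 0..p.2, y ^ j * f (p.1, y)
      have hJ : IsPiecewisePoly (n + j + 1) J := ih j
      have hJs : IsPiecewisePoly (n + j + 1) (fun p : E × ℝ => J (p.1, s p)) :=
        hJ.comp_affine (fst.prod s)
      have hJ0 : IsPiecewisePoly (n + j + 1) (fun p : E × ℝ => J (p.1, max 0 (s p))) := by
        convert hJs.ite_lt ((const 0).mono (Nat.zero_le _)) s using 2 with p
        split_ifs with h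
        · rw [max_eq_right h.le]
        · rw [max_eq_left (not_lt.1 h)]; simp [J]
      have hJm : IsPiecewisePoly (n + j + 1) (fun p : E × ℝ => J (p.1, max p.2 (s p))) := by
        convert hJ.ite_lt hJs (snd - s) using 2 with p
        have : (snd - s) p = p.2 - s p := rfl
        simp only [this, sub_pos]
        split_ifs with h
        · rw [max_eq_left h.le]
        · rw [max_eq_right (not_lt.1 h)]
      have key : ∀ p : E × ℝ, ∫ y in 0..p.2, (if s p < y then y ^ j * f (p.1, y) else 0)
          = J (p.1, max p.2 (s p)) - J (p.1, max 0 (s p)) := fun p => by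
        rw [intervalIntegral_ite_lt]
        simp only [J]
        rw [intervalIntegral.integral_interval_sub_left (hint _ _ _) (hint _ _ _)]
      have hl : ∀ (p : E × ℝ) (y : ℝ), l (p.1, y) = c * (y - s p) := fun p y => by
        rw [AffineMap.prod_apply_eq, hs]
        field_simp
        ring
      rcases lt_or_gt_of_ne hc with hneg | hpos
      -- For negative slope the cut keeps `y < s p`, which up to the null set `y = s p` is the
      -- complement of the case handled by `key`.
      · convert (ih j).sub (hJm.sub hJ0) using 2 with p
        rw [← key p]
        rw [← intervalIntegral.integral_sub (hint _ _ _)]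
        · refine intervalIntegral.integral_congr_ae ?_
          have : ∀ᵐ y : ℝ, y ≠ s p := by simp [ae_iff]
          filter_upwards [this] with y hy _
          rw [hl]
          rcases lt_or_gt_of_ne hy with h | h
          · rw [if_pos (mul_pos_of_neg_of_neg hneg (by linarith)), if_neg (not_lt.2 h.le), sub_zero]
          · rw [if_neg (not_lt.2 (mul_nonpos_of_nonpos_of_nonneg hneg.le (by linarith))), if_pos h]
            simp
        · have := ((hf.pow_mul_comp_prodMk p.1 j).cut
            (AffineMap.id ℝ ℝ - AffineMap.const ℝ ℝ (s p))).intervalIntegrable 0 p.2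
          simpa [sub_pos] using this
      · convert hJm.sub hJ0 using 2 with p
        rw [← key p]
        refine intervalIntegral.integral_congr fun y _ => ?_
        simp only [hl, mul_pos_iff_of_pos_left hpos, sub_pos, mul_ite, mul_zero]

theorem intervalIntegral {n : ℕ} {f : E × ℝ → ℝ} (hf : IsPiecewisePoly n f) (a b : ℝ) :
    IsPiecewisePoly (n + 1) (fun x => ∫ y in a..b, f (x, y)) := by
  have h := hf.integral_pow_mul 0
  have h' : ∀ u : ℝ, IsPiecewisePoly (n + 1) (fun x => ∫ y in 0..u, f (x, y)) := fun u => by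
    simpa using h.comp_affine ((AffineMap.id ℝ E).prod (AffineMap.const ℝ E u))
  convert (h' b).sub (h' a) using 2 with x
  rw [intervalIntegral.integral_interval_sub_left] <;>
    exact (hf.comp_prodMk x).intervalIntegrable _ _

end Integral

/-- Fubini, one coordinate at a time: the first coordinate of the box is moved to the parameter
space, which becomes `E × ℝ`, and is integrated last. -/
theorem setIntegral_pi_Icc {d n : ℕ} {E : Type} [NormedAddCommGroup E] [NormedSpace ℝ E]
    [FiniteDimensional ℝ E] {f : E × (Fin d → ℝ) → ℝ} (hf : IsPiecewisePoly n f) {M : ℝ}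
    (hM : 0 ≤ M) :
    IsPiecewisePoly (n + d)
      (fun x => ∫ y in univ.pi fun _ : Fin d => Icc (-M) M, f (x, y)) := by
  induction d generalizing E with
  | zero =>
    refine (hf.comp_affine ((AffineMap.id ℝ E).prod (AffineMap.const ℝ E 0))).congr fun x => ?_
    rw [show (univ.pi fun _ : Fin 0 => Icc (-M) M) = univ by ext; simp, Measure.restrict_univ,
      volume_pi, Measure.pi_of_empty, integral_dirac]
    exact congrArg (fun y => f (x, y)) (Subsingleton.elim _ _)
  | succ d ih =>
    let cons : (E × ℝ) × (Fin d → ℝ) →ₗ[ℝ] E × (Fin (d + 1) → ℝ) :=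
      { toFun := fun p => (p.1.1, Fin.cons p.1.2 p.2)
        map_add' := fun p q => by
          ext i
          · rfl
          · refine Fin.cases ?_ (fun i => ?_) i <;> simp
        map_smul' := fun c p => by
          ext i
          · rfl
          · refine Fin.cases ?_ (fun i => ?_) i <;> simp }
    have h₁ := (ih (hf.comp_affine cons.toAffineMap)).intervalIntegral (-M) M
    refine h₁.congr fun x => ?_
    have e := (volume_preserving_piFinSuccAbove (fun _ : Fin (d + 1) => ℝ) 0).symm
    have hpre : (MeasurableEquiv.piFinSuccAbove (fun _ : Fin (d + 1) => ℝ) 0).symm ⁻¹'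
        (univ.pi fun _ => Icc (-M) M) = Icc (-M) M ×ˢ univ.pi fun _ : Fin d => Icc (-M) M := by
      ext p
      simp only [mem_preimage, mem_pi, mem_univ, forall_true_left, mem_prod, Fin.forall_fin_succ,
        MeasurableEquiv.piFinSuccAbove_symm_apply, Fin.insertNthEquiv_zero, Fin.consEquiv_apply,
        Fin.cons_zero, Fin.cons_succ]
    have hcons : ∀ p : ℝ × (Fin d → ℝ),
        (MeasurableEquiv.piFinSuccAbove (fun _ : Fin (d + 1) => ℝ) 0).symm p
          = Fin.cons p.1 p.2 := fun p => by
      rw [MeasurableEquiv.piFinSuccAbove_symm_apply, Fin.insertNthEquiv_zero]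
      rfl
    rw [← e.setIntegral_preimage_emb (MeasurableEquiv.measurableEmbedding _), hpre,
      intervalIntegral.integral_of_le (by linarith), ← integral_Icc_eq_integral_Ioc,
      Measure.volume_eq_prod, setIntegral_prod]
    · simp only [hcons]
      rfl
    · let B : ℝ × (Fin d → ℝ) →ᵃ[ℝ] (E × ℝ) × (Fin d → ℝ) :=
        ((AffineMap.const ℝ _ x).prod (LinearMap.fst ℝ ℝ (Fin d → ℝ)).toAffineMap).prod
          (LinearMap.snd ℝ ℝ (Fin d → ℝ)).toAffineMap
      have := ((hf.comp_affine cons.toAffineMap).comp_affine B).integrableOn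
        (isCompact_Icc.prod (isCompact_univ_pi fun _ : Fin d => isCompact_Icc (a := -M) (b := M)))
        (volume.prod volume) (K := Icc (-M) M ×ˢ _)
      simp only [hcons]
      exact this

/-- On the line, a piecewise polynomial function is polynomial off a finite set. -/
theorem exists_finset {n : ℕ} {f : ℝ → ℝ} (hf : IsPiecewisePoly n f) :
    ∃ S : Finset ℝ, ∀ a b : ℝ, (∀ s ∈ S, s ∉ Ioo a b) →
      ∃ p : Polynomial ℝ, p.natDegree ≤ n ∧ ∀ r ∈ Ioo a b, f r = p.eval r := by
  classical
  have hl : ∀ (l : ℝ →ᵃ[ℝ] ℝ) (r : ℝ), l r = l 0 + r * l.linear 1 := fun l r => by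
    have := l.map_vadd 0 (r • (1 : ℝ))
    rw [map_smul] at this
    simpa [add_comm] using this
  induction hf with
  | const c => exact ⟨∅, fun a b _ => ⟨Polynomial.C c, by simp⟩⟩
  | succ _ ih =>
    obtain ⟨S, hS⟩ := ih
    refine ⟨S, fun a b h => ?_⟩
    obtain ⟨p, hp, h⟩ := hS a b h
    exact ⟨p, by omega, h⟩
  | add _ _ ih₁ ih₂ =>
    obtain ⟨S, hS⟩ := ih₁
    obtain ⟨T, hT⟩ := ih₂
    refine ⟨S ∪ T, fun a b h => ?_⟩
    obtain ⟨p, hp, h₁⟩ := hS a b fun s hs => h s (Finset.mem_union_left _ hs)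
    obtain ⟨q, hq, h₂⟩ := hT a b fun s hs => h s (Finset.mem_union_right _ hs)
    exact ⟨p + q, Polynomial.natDegree_add_le_of_degree_le hp hq, fun r hr => by
      simp [h₁ r hr, h₂ r hr]⟩
  | affine_mul l _ ih =>
    obtain ⟨S, hS⟩ := ih
    refine ⟨S, fun a b h => ?_⟩
    obtain ⟨p, hp, h⟩ := hS a b h
    refine ⟨(Polynomial.C (l.linear 1) * Polynomial.X + Polynomial.C (l 0)) * p, ?_, fun r hr => ?_⟩
    · refine Polynomial.natDegree_mul_le.trans ?_
      have := Polynomial.natDegree_linear_le (a := l.linear 1) (b := l 0)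
      omega
    · dsimp only
      rw [h r hr, hl l r]
      simp only [Polynomial.eval_mul, Polynomial.eval_add, Polynomial.eval_C, Polynomial.eval_X]
      ring
  | cut l _ ih =>
    obtain ⟨S, hS⟩ := ih
    -- The new exceptional point is the zero of `l`; if `l` has slope zero, the value is a harmless
    -- extra point. Away from it `l` cannot change sign, by the intermediate value theorem.
    refine ⟨insert (-l 0 / l.linear 1) S, fun a b h => ?_⟩
    obtain ⟨p, hp, hfp⟩ := hS a b fun s hs => h s (Finset.mem_insert_of_mem hs)
    by_cases hpos : ∀ r ∈ Ioo a b, 0 < l r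
    · exact ⟨p, hp, fun r hr => by dsimp only; rw [if_pos (hpos r hr), hfp r hr]⟩
    push Not at hpos
    obtain ⟨r₀, hr₀, hle⟩ := hpos
    refine ⟨0, by simp, fun r hr => ?_⟩
    dsimp only
    rw [if_neg, Polynomial.eval_zero]
    intro hlt
    obtain ⟨z, hz, hz0⟩ := isPreconnected_Ioo.intermediate_value hr₀ hr
      l.continuous_of_finiteDimensional.continuousOn ⟨hle, hlt.le⟩
    rw [hl] at hz0
    rcases eq_or_ne (l.linear 1) 0 with h0 | h0
    · rw [hl, h0] at hlt
      rw [h0] at hz0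
      linarith
    · refine h _ (Finset.mem_insert_self _ _) ?_
      have : -l 0 / l.linear 1 = z := by field_simp; linarith
      rwa [this]

end IsPiecewisePoly

/-! ### Differentiability from partial derivatives -/

/-- A function on `ℝ^ι` whose partial derivatives exist everywhere and are continuous at a point is
differentiable at that point. -/
theorem hasFDerivAt_pi_of_partial {ι : Type*} [Fintype ι] [DecidableEq ι] {f : (ι → ℝ) → ℝ}
    {g : ι → (ι → ℝ) → ℝ} {t₀ : ι → ℝ}
    (hf : ∀ j t, HasDerivAt (fun s => f (Function.update t j s)) (g j t) (t j))
    (hg : ∀ j, ContinuousAt (g j) t₀) :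
    HasFDerivAt f (∑ j, g j t₀ • ContinuousLinearMap.proj (R := ℝ) (φ := fun _ : ι => ℝ) j) t₀ := by
  -- The coordinates are released one at a time: those in `s` follow `y`, the others stay frozen at
  -- `t₀`. Each release is controlled by the mean value inequality in a single variable.
  have key : ∀ s : Finset ι, HasFDerivAt (fun y => f (s.piecewise y t₀))
      (∑ j ∈ s, g j t₀ • ContinuousLinearMap.proj (R := ℝ) (φ := fun _ : ι => ℝ) j) t₀ := by
    intro s
    induction s using Finset.induction_on with
    | empty => simpa using hasFDerivAt_const (f t₀) t₀
    | insert j s hj ih =>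
      rw [Finset.sum_insert hj]
      have hD : HasFDerivAt
          (fun y => f (Function.update (s.piecewise y t₀) j (y j)) - f (s.piecewise y t₀))
          (g j t₀ • ContinuousLinearMap.proj (R := ℝ) (φ := fun _ : ι => ℝ) j) t₀ := by
        rw [hasFDerivAt_iff_isLittleO, Asymptotics.isLittleO_iff]
        intro ε hε
        obtain ⟨δ, hδ, hball⟩ := Metric.continuousAt_iff.1 (hg j) ε hε
        filter_upwards [Metric.ball_mem_nhds t₀ hδ] with y hy
        have hw : ∀ u ∈ uIcc (t₀ j) (y j),
            dist (Function.update (s.piecewise y t₀) j u) t₀ < δ := by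
          intro u hu
          refine lt_of_le_of_lt ((dist_pi_le_iff dist_nonneg).2 fun i => ?_) hy
          rcases eq_or_ne i j with rfl | hij
          · rw [Function.update_self]
            exact (Real.dist_right_le_of_mem_uIcc (by rwa [uIcc_comm])).trans
              (dist_le_pi_dist y t₀ i)
          · rw [Function.update_of_ne hij]
            by_cases his : i ∈ s
            · rw [Finset.piecewise_eq_of_mem _ _ _ his]
              exact dist_le_pi_dist y t₀ i
            · rw [Finset.piecewise_eq_of_notMem _ _ _ his, dist_self]
              exact dist_nonneg
        have hder : ∀ u ∈ uIcc (t₀ j) (y j), HasDerivWithinAt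
            (fun u => f (Function.update (s.piecewise y t₀) j u) - g j t₀ * u)
            (g j (Function.update (s.piecewise y t₀) j u) - g j t₀) (uIcc (t₀ j) (y j)) u := by
          intro u _
          have h := hf j (Function.update (s.piecewise y t₀) j u)
          simp only [Function.update_idem, Function.update_self] at h
          have h' := h.sub ((hasDerivAt_id u).const_mul (g j t₀))
          rw [mul_one] at h'
          exact h'.hasDerivWithinAt
        have hmv := (convex_uIcc (t₀ j) (y j)).norm_image_sub_le_of_norm_hasDerivWithin_le hder
          (fun u hu => (hball (hw u hu)).le) left_mem_uIcc right_mem_uIcc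
        have h₀ : Function.update (s.piecewise y t₀) j (t₀ j) = s.piecewise y t₀ := by
          rw [Function.update_eq_self_iff, Finset.piecewise_eq_of_notMem _ _ _ hj]
        rw [h₀] at hmv
        have h₁ : Function.update (s.piecewise t₀ t₀) j (t₀ j) = s.piecewise t₀ t₀ := by
          rw [Function.update_eq_self_iff, Finset.piecewise_eq_of_notMem _ _ _ hj]
        rw [h₁]
        refine le_trans (le_of_eq ?_) (hmv.trans
          (mul_le_mul_of_nonneg_left (norm_le_pi_norm (y - t₀) j) hε.le))
        simp only [sub_self, sub_zero, smul_apply, ContinuousLinearMap.proj_apply, Pi.sub_apply, smul_eq_mul]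
        congr 1
        ring
      refine (hD.add ih).congr_of_eventuallyEq (Filter.Eventually.of_forall fun y => ?_)
      simp [Finset.piecewise_insert]
  simpa using key Finset.univ

/-! ### Slicing Haar measure along a functional -/

section Slice

variable {E : Type*} [NormedAddCommGroup E] [NormedSpace ℝ E] [FiniteDimensional ℝ E]

/-- The splitting of `E` as the kernel of a functional `l` plus the line spanned by a vector `v`
with `l v = 1`. -/
noncomputable def kerProdEquiv (l : E →L[ℝ] ℝ) {v : E} (hv : l v = 1) :
    (l.ker × ℝ) ≃L[ℝ] E :=
  LinearEquiv.toContinuousLinearEquiv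
    { toFun := fun p => p.1 + p.2 • v
      map_add' := fun p q => by simp [add_smul]; abel
      map_smul' := fun c p => by simp [mul_smul]
      invFun := fun x => (⟨x - l x • v, by simp [hv]⟩, l x)
      left_inv := fun p => by
        have : l (p.1 : E) = 0 := p.1.2
        ext <;> simp [hv, this]
      right_inv := fun x => by simp }

variable [MeasurableSpace E] [BorelSpace E]

/-- Uniqueness of Haar measure: transported to `l.ker × ℝ`, `μ` is a multiple of the product
measure, and Fubini applies. The value of `c` is irrelevant, only `c ≠ 0` matters. -/
theorem exists_measure_eq_lintegral_slice (μ : Measure E) [μ.IsAddHaarMeasure] (l : E →L[ℝ] ℝ)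
    {v : E} (hv : l v = 1) : ∃ c : NNReal, c ≠ 0 ∧ ∀ s : Set E, MeasurableSet s →
      μ s = c * ∫⁻ y : ℝ, (Measure.addHaar : Measure l.ker) {z | (z : E) + y • v ∈ s} := by
  let e := kerProdEquiv l hv
  let ν : Measure l.ker := Measure.addHaar
  have h : μ.map e.symm = _ := Measure.isAddLeftInvariant_eq_smul (μ.map e.symm) (ν.prod volume)
  refine ⟨Measure.addHaarScalarFactor (μ.map e.symm) (ν.prod volume),
    (Measure.addHaarScalarFactor_pos_of_isAddHaarMeasure _ _).ne', fun s hs => ?_⟩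
  have hs' : MeasurableSet (e ⁻¹' s) := e.continuous.measurable hs
  have h₁ : μ s = μ.map e.symm (e ⁻¹' s) := by
    rw [Measure.map_apply e.symm.continuous.measurable hs', ← preimage_comp]
    simp
  refine h₁.trans ((congrArg (fun m : Measure _ => m (e ⁻¹' s)) h).trans ?_)
  rw [Measure.smul_apply, Measure.prod_apply_symm hs']
  rfl

end Slice

/-! ### Volume of a polyhedron as a function of its support numbers -/

section PolyhedronVolume

variable {ι E : Type} [NormedAddCommGroup E] [NormedSpace ℝ E]

/-- The intersection of the half-spaces `t i ≤ L i x`, for `i ∈ A`. -/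
def polyhedron (L : ι → E →L[ℝ] ℝ) (A : Finset ι) (t : ι → ℝ) : Set E :=
  {x | ∀ i ∈ A, t i ≤ L i x}

theorem isClosed_polyhedron (L : ι → E →L[ℝ] ℝ) (A : Finset ι) (t : ι → ℝ) :
    IsClosed (polyhedron L A t) := by
  simp only [polyhedron, ofPred_forall]
  exact isClosed_biInter fun i _ => isClosed_le continuous_const (L i).continuous

variable {L : ι → E →L[ℝ] ℝ} {A : Finset ι}

/-- Since `L j` vanishes on its kernel, the restricted polyhedron lies in the original one with
`j`-th support number `0`. -/
theorem isBounded_polyhedron_ker [DecidableEq ι]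
    (hb : ∀ t, Bornology.IsBounded (polyhedron L A t)) (j : ι) (t : ι → ℝ) :
    Bornology.IsBounded
      (polyhedron (fun i => (L i).comp (L j).ker.subtypeL) (A.erase j) t) := by
  obtain ⟨C, hC⟩ := (hb (Function.update t j 0)).exists_norm_le
  refine isBounded_iff_forall_norm_le.2 ⟨C, fun z hz => hC z fun i hi => ?_⟩
  rcases eq_or_ne i j with rfl | hij
  · rw [Function.update_self, show L i z = 0 from z.2]
  · rw [Function.update_of_ne hij]
    exact hz i (Finset.mem_erase.2 ⟨hij, hi⟩)

variable [FiniteDimensional ℝ E] [MeasurableSpace E]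

theorem measure_polyhedron_lt_top (μ : Measure E) [μ.IsAddHaarMeasure]
    (hb : ∀ t, Bornology.IsBounded (polyhedron L A t)) (t : ι → ℝ) :
    μ (polyhedron L A t) < ⊤ :=
  (hb t).measure_lt_top

variable [BorelSpace E]

theorem addHaar_setOf_eq (μ : Measure E) [μ.IsAddHaarMeasure] {l : E →L[ℝ] ℝ} (hl : l ≠ 0)
    (a : ℝ) : μ {x | l x = a} = 0 := by
  let S : AffineSubspace ℝ E := (AffineSubspace.mk' a ⊥).comap l.toLinearMap.toAffineMap
  have hS : (S : Set E) = {x | l x = a} := by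
    ext x
    simp [S, AffineSubspace.mem_mk', sub_eq_zero]
  rw [← hS]
  refine Measure.addHaar_affineSubspace μ S fun h => hl ?_
  have hall : ∀ x, l x = a := fun x => by
    have : x ∈ {x | l x = a} := by rw [← hS, h]; simp
    exact this
  ext x
  simpa [hall x] using (hall 0).symm

variable [Finite ι]

/-- Dominated convergence: off the null set of bounding hyperplanes, membership is locally constant
in `t`, and near `t₀` all the polyhedra lie in the one for `t₀ - 1`, of finite measure. -/
theorem continuous_measureReal_polyhedron (μ : Measure E) [μ.IsAddHaarMeasure]
    (hb : ∀ t, Bornology.IsBounded (polyhedron L A t)) (hL : ∀ i ∈ A, L i ≠ 0) :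
    Continuous fun t => μ.real (polyhedron L A t) := by
  refine continuous_iff_continuousAt.2 fun t₀ => ?_
  refine (ENNReal.tendsto_toReal (measure_polyhedron_lt_top μ hb t₀).ne).comp ?_
  have : Fintype ι := Fintype.ofFinite ι
  refine tendsto_measure_of_ae_tendsto_indicator (nhds t₀) (isClosed_polyhedron L A t₀).measurableSet
    (fun t => (isClosed_polyhedron L A t).measurableSet)
    (isClosed_polyhedron L A fun i => t₀ i - 1).measurableSet
    (measure_polyhedron_lt_top μ hb _).ne ?_ ?_
  · have : ∀ᶠ t in nhds t₀, ∀ i, t₀ i - 1 < t i := Filter.eventually_all.2 fun i =>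
      (continuous_apply i).continuousAt.eventually (lt_mem_nhds (sub_one_lt (t₀ i)))
    filter_upwards [this] with t ht x hx i hi
    exact (ht i).le.trans (hx i hi)
  · have : ∀ᵐ x ∂μ, ∀ i ∈ A, L i x ≠ t₀ i := by
      refine (ae_ball_iff A.countable_toSet).2 fun i hi => ?_
      simpa [ae_iff] using addHaar_setOf_eq μ (hL i hi) (t₀ i)
    filter_upwards [this] with x hx
    have : ∀ᶠ t in nhds t₀, ∀ i ∈ A, (t i ≤ L i x ↔ t₀ i ≤ L i x) := by
      refine (Filter.eventually_all_finset A).2 fun i hi => ?_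
      have hc := (continuous_apply (A := fun _ : ι => ℝ) i).continuousAt (x := t₀)
      rcases lt_or_gt_of_ne (hx i hi) with h | h
      · filter_upwards [hc.eventually (lt_mem_nhds h)] with t ht
        exact iff_of_false (not_le.2 ht) (not_le.2 h)
      · filter_upwards [hc.eventually (gt_mem_nhds h)] with t ht
        exact iff_of_true ht.le h.le
    filter_upwards [this] with t ht
    exact forall₂_congr ht

/-- The partial derivatives of the volume of a polyhedron as a function of its support numbers are
multiples of the volumes of its facets. -/
theorem exists_hasDerivAt_measureReal_polyhedron [DecidableEq ι] (μ : Measure E)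
    [μ.IsAddHaarMeasure] (hb : ∀ t, Bornology.IsBounded (polyhedron L A t)) {j : ι} (hj : j ∈ A)
    {v : E} (hv : L j v = 1)
    (hL : ∀ i ∈ A.erase j, (L i).comp (L j).ker.subtypeL ≠ 0) :
    ∃ c : ℝ, ∀ t : ι → ℝ,
      HasDerivAt (fun s => μ.real (polyhedron L A (Function.update t j s)))
        (-(c * (Measure.addHaar : Measure (L j).ker).real
          (polyhedron (fun i => (L i).comp (L j).ker.subtypeL) (A.erase j)
            fun i => t i - t j * L i v))) (t j) := by
  obtain ⟨c, hc, hslice⟩ := exists_measure_eq_lintegral_slice μ (L j) hv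
  refine ⟨c, fun t => ?_⟩
  let L' : ι → (L j).ker →L[ℝ] ℝ := fun i => (L i).comp (L j).ker.subtypeL
  let ν : Measure (L j).ker := Measure.addHaar
  let G : ℝ → ENNReal := fun u => ν (polyhedron L' (A.erase j) fun i => t i - u * L i v)
  have hb' : ∀ t, Bornology.IsBounded (polyhedron L' (A.erase j) t) :=
    isBounded_polyhedron_ker hb j
  have hGtop : ∀ u, G u < ⊤ := fun u => measure_polyhedron_lt_top ν hb' _
  have hGcont : Continuous fun u => (G u).toReal :=
    (continuous_measureReal_polyhedron ν hb' hL).comp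
      (continuous_pi fun i => by fun_prop)
  have hGmeas : Measurable G := by
    have : G = fun u => ENNReal.ofReal (G u).toReal := by
      ext u
      rw [ENNReal.ofReal_toReal (hGtop u).ne]
    rw [this]
    exact hGcont.measurable.ennreal_ofReal
  -- The slice at height `u` is empty for `u < s` and otherwise does not depend on `s`. Hence the
  -- volume is `c` times the integral of `G` over `[s, ∞)`, and the fundamental theorem of calculus
  -- gives the derivative.
  have hset : ∀ s u : ℝ, ν {z | (z : E) + u • v ∈ polyhedron L A (Function.update t j s)}
      = (Ici s).indicator G u := by
    intro s u
    have hjz : ∀ z : (L j).ker, L j (z + u • v) = u := fun z => by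
      rw [map_add, show L j z = 0 from z.2, map_smul, hv]
      simp
    by_cases hsu : s ≤ u
    · rw [indicator_of_mem (mem_Ici.2 hsu)]
      congr 1
      ext z
      constructor
      · intro hz i hi
        have := hz i (Finset.mem_of_mem_erase hi)
        rw [Function.update_of_ne (Finset.ne_of_mem_erase hi), map_add, map_smul, smul_eq_mul]
          at this
        exact sub_le_iff_le_add.2 this
      · intro hz i hi
        rcases eq_or_ne i j with rfl | hij
        · rwa [Function.update_self, hjz]
        · rw [Function.update_of_ne hij, map_add, map_smul, smul_eq_mul]
          exact sub_le_iff_le_add.1 (hz i (Finset.mem_erase.2 ⟨hij, hi⟩))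
    · rw [indicator_of_notMem (by simpa using hsu)]
      convert measure_empty (μ := ν)
      refine eq_empty_of_forall_notMem fun z hz => hsu ?_
      have := hz j hj
      rwa [Function.update_self, hjz] at this
  have hV : ∀ s, μ (polyhedron L A (Function.update t j s)) = c * ∫⁻ u in Ici s, G u := by
    intro s
    rw [hslice _ (isClosed_polyhedron L A _).measurableSet, ← lintegral_indicator
      measurableSet_Ici]
    exact congrArg _ (lintegral_congr fun u => hset s u)
  have hfin : ∀ s, ∫⁻ u in Ici s, G u ≠ ⊤ := by
    intro s h
    have := (measure_polyhedron_lt_top μ hb (Function.update t j s)).ne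
    rw [hV, h, ENNReal.mul_top (by simpa using hc)] at this
    exact this rfl
  have hint : ∀ s, IntegrableOn (fun u => (G u).toReal) (Ici s) := fun s =>
    integrable_toReal_of_lintegral_ne_top hGmeas.aemeasurable (hfin s)
  have hVr : ∀ s, μ.real (polyhedron L A (Function.update t j s))
      = μ.real (polyhedron L A (Function.update t j (t j)))
        - c * ∫ u in (t j)..s, (G u).toReal := by
    have h₁ : ∀ s, μ.real (polyhedron L A (Function.update t j s))
        = c * ∫ u in Ici s, (G u).toReal := fun s => by
      rw [Measure.real, hV, ENNReal.toReal_mul,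
        integral_toReal hGmeas.aemeasurable (ae_of_all _ hGtop)]
      rfl
    intro s
    rw [h₁, h₁, ← intervalIntegral.integral_Ici_sub_Ici' (hint _) (hint _)]
    ring
  have hd := ((intervalIntegral.integral_hasDerivAt_right
    (hGcont.intervalIntegrable (t j) (t j)) (hGcont.stronglyMeasurableAtFilter _ _)
    hGcont.continuousAt).const_mul (c : ℝ)).const_sub
      (μ.real (polyhedron L A (Function.update t j (t j))))
  exact hd.congr_of_eventuallyEq (Filter.Eventually.of_forall hVr)

end PolyhedronVolume

/-- If any `k + 1` of the functionals are linearly independent (expressed by dual vectors), the volume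
of a polyhedron is of class `C^k` as a function of its support numbers. -/
theorem contDiff_measureReal_polyhedron {ι : Type} [Fintype ι] [DecidableEq ι] (k : ℕ) {E : Type}
    [NormedAddCommGroup E] [NormedSpace ℝ E] [FiniteDimensional ℝ E] [MeasurableSpace E]
    [BorelSpace E] (μ : Measure E) [μ.IsAddHaarMeasure] {L : ι → E →L[ℝ] ℝ} {A : Finset ι}
    (hb : ∀ t, Bornology.IsBounded (polyhedron L A t))
    (hL : ∀ S ⊆ A, S.card ≤ k + 1 → ∀ i ∈ S, ∃ v, L i v ≠ 0 ∧ ∀ l ∈ S, l ≠ i → L l v = 0) :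
    ContDiff ℝ k fun t => μ.real (polyhedron L A t) := by
  have hne : ∀ i ∈ A, ∃ v, L i v = 1 := fun i hi => by
    obtain ⟨v, hv, -⟩ := hL {i} (by simpa using hi) (by simp) i (by simp)
    exact ⟨(L i v)⁻¹ • v, by simp [hv]⟩
  have hne' : ∀ i ∈ A, L i ≠ 0 := fun i hi h => by
    obtain ⟨v, hv⟩ := hne i hi
    simp [h] at hv
  induction k generalizing E A with
  | zero => exact contDiff_zero.2 (continuous_measureReal_polyhedron μ hb hne')
  | succ k ih =>
    have hpart : ∀ j, ∃ g : (ι → ℝ) → ℝ, ContDiff ℝ k g ∧ ∀ t, HasDerivAt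
        (fun s => μ.real (polyhedron L A (Function.update t j s))) (g t) (t j) := by
      intro j
      by_cases hj : j ∈ A
      · obtain ⟨v, hv⟩ := hne j hj
        -- A vector dual to `i` within `insert j S` is annihilated by `L j`, so it already lies in
        -- the kernel. Adding `j` to `S` is what costs one degree of independence.
        have hind : ∀ S ⊆ A.erase j, S.card ≤ k + 1 → ∀ i ∈ S,
            ∃ z : (L j).ker, ((L i).comp (L j).ker.subtypeL) z ≠ 0 ∧
              ∀ l ∈ S, l ≠ i → ((L l).comp (L j).ker.subtypeL) z = 0 := by
          intro S hS hcard i hi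
          have hjS : j ∉ S := fun h => (Finset.mem_erase.1 (hS h)).1 rfl
          obtain ⟨w, hw, hw0⟩ := hL (insert j S)
            (Finset.insert_subset hj (hS.trans (Finset.erase_subset j A)))
            (by rw [Finset.card_insert_of_notMem hjS]; omega) i (Finset.mem_insert_of_mem hi)
          refine ⟨⟨w, hw0 j (Finset.mem_insert_self j S) ?_⟩, hw, fun l hl hli =>
            hw0 l (Finset.mem_insert_of_mem hl) hli⟩
          rintro rfl
          exact hjS hi
        have hne'' : ∀ i ∈ A.erase j, ∃ z, ((L i).comp (L j).ker.subtypeL) z = 1 := fun i hi => by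
          obtain ⟨z, hz, -⟩ := hind {i} (by simpa using hi) (by simp) i (by simp)
          exact ⟨(((L i).comp (L j).ker.subtypeL) z)⁻¹ • z, by
            rw [map_smul, smul_eq_mul, inv_mul_cancel₀ hz]⟩
        have hne3 : ∀ i ∈ A.erase j, (L i).comp (L j).ker.subtypeL ≠ 0 := fun i hi h => by
          obtain ⟨z, hz⟩ := hne'' i hi
          simp [h] at hz
        obtain ⟨c, hc⟩ := exists_hasDerivAt_measureReal_polyhedron μ hb hj hv hne3
        refine ⟨_, ?_, hc⟩
        have := ih (Measure.addHaar : Measure (L j).ker) (isBounded_polyhedron_ker hb j) hind hne''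
          hne3
        refine (contDiff_const.mul (this.comp ?_)).neg
        exact contDiff_pi.2 fun i => by fun_prop
      · refine ⟨fun _ => 0, contDiff_const, fun t => ?_⟩
        refine (hasDerivAt_const (t j) (μ.real (polyhedron L A t))).congr_of_eventuallyEq
          (Filter.Eventually.of_forall fun s => ?_)
        have : polyhedron L A (Function.update t j s) = polyhedron L A t := by
          ext x
          refine forall₂_congr fun i hi => ?_
          rw [Function.update_of_ne (ne_of_mem_of_not_mem hi hj)]
        exact congrArg _ this
    choose g hg hder using hpart
    refine contDiff_succ_iff_hasFDerivAt.2
      ⟨fun t => ∑ j, g j t • ContinuousLinearMap.proj (R := ℝ) (φ := fun _ : ι => ℝ) j, ?_,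
        fun t => hasFDerivAt_pi_of_partial hder fun j => (hg j).continuous.continuousAt⟩
    exact ContDiff.sum fun j _ => (hg j).smul contDiff_const

/-! ### From piecewise polynomials to pluri-phase functions -/

/-- A continuous function that is piecewise polynomial of degree at most `d` and eventually constant
is a pluri-phase Steiner-like function. -/
theorem IsPiecewisePoly.isPluriphaseSteinerLike {d : ℕ} {φ f : ℝ → ℝ} (hf : IsPiecewisePoly d f)
    (hφf : ∀ r, 0 ≤ r → φ r = f r) (hcont : ContinuousOn φ (Ici 0)) (hnn : ∀ r, 0 ≤ r → 0 ≤ φ r)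
    {R c : ℝ} (hR : 0 < R) (hc : ∀ r, R ≤ r → φ r = c) : IsPluriphaseSteinerLike d φ := by
  obtain ⟨S, hS⟩ := hf.exists_finset
  -- The breakpoints are `0`, `R` and the exceptional points strictly between them, listed in
  -- increasing order by `g`.
  let T : Finset ℝ := insert 0 (insert R (S.filter fun s => 0 < s ∧ s < R))
  have h0T : (0 : ℝ) ∈ T := Finset.mem_insert_self _ _
  have hRT : R ∈ T := Finset.mem_insert_of_mem (Finset.mem_insert_self _ _)
  have hT : ∀ t ∈ T, 0 ≤ t ∧ t ≤ R := fun t ht => by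
    simp only [T, Finset.mem_insert, Finset.mem_filter] at ht
    rcases ht with rfl | rfl | ⟨-, h₁, h₂⟩
    · exact ⟨le_rfl, hR.le⟩
    · exact ⟨hR.le, le_rfl⟩
    · exact ⟨h₁.le, h₂.le⟩
  obtain ⟨n, hn⟩ : ∃ n, T.card = n + 1 :=
    Nat.exists_eq_succ_of_ne_zero (Finset.card_ne_zero_of_mem h0T)
  let g : Fin (n + 1) ↪o ℝ := T.orderEmbOfFin hn
  have hgT : ∀ i, g i ∈ T := Finset.orderEmbOfFin_mem T hn
  have hrange : ∀ t ∈ T, ∃ i, g i = t := fun t ht => by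
    have : t ∈ range g := by rw [Finset.range_orderEmbOfFin]; exact ht
    exact this
  have hg0 : g 0 = 0 := by
    obtain ⟨i, hi⟩ := hrange 0 h0T
    exact le_antisymm (hi ▸ g.monotone (Fin.zero_le i)) (hT _ (hgT 0)).1
  have hglast : g (Fin.last n) = R := by
    obtain ⟨i, hi⟩ := hrange R hRT
    exact le_antisymm (hT _ (hgT _)).2 (hi ▸ g.monotone (Fin.le_last i))
  refine ⟨hcont, hnn, n, g, hg0, g.strictMono, fun i => ?_, c, fun r hr => hc r (hglast ▸ hr)⟩
  have hlt : g i.castSucc < g i.succ := g.strictMono i.castSucc_lt_succ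
  have hgi : 0 ≤ g i.castSucc := (hT _ (hgT _)).1
  obtain ⟨p, hp, hpf⟩ := hS (g i.castSucc) (g i.succ) fun s hs hmem => by
    obtain ⟨k, hk⟩ := hrange s (by
      simp only [T, Finset.mem_insert, Finset.mem_filter]
      exact Or.inr (Or.inr ⟨hs, hgi.trans_lt hmem.1, hmem.2.trans_le (hT _ (hgT _)).2⟩))
    rw [← hk, mem_Ioo, g.lt_iff_lt, g.lt_iff_lt] at hmem
    exact absurd hmem.2 (not_lt.2 (Fin.castSucc_lt_iff_succ_le.1 hmem.1))
  refine ⟨p, hp, ?_⟩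
  have heq : EqOn φ (fun r => p.eval r) (Ioo (g i.castSucc) (g i.succ)) := fun r hr => by
    rw [hφf r (hgi.trans hr.1.le), hpf r hr]
  -- Continuity carries the identity from the open interval to its endpoints.
  exact heq.of_subset_closure (hcont.mono fun r hr => hgi.trans hr.1) p.continuous.continuousOn
    Ioo_subset_Icc_self (closure_Ioo hlt.ne).ge

/-! ### Polytopes, inner parallel bodies and absolute rank -/

section HalfSpaces

variable {d m : ℕ} {P : Set (EuclideanSpace ℝ (Fin d))} {N : Fin m → EuclideanSpace ℝ (Fin d)}
  {b : Fin m → ℝ}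

theorem iInter_closedHalfSpace (N : Fin m → EuclideanSpace ℝ (Fin d)) (b : Fin m → ℝ) :
    ⋂ j, closedHalfSpace (N j) (b j) = polyhedron (fun j => innerSL ℝ (N j)) Finset.univ b := by
  ext x
  simp [closedHalfSpace, polyhedron]

theorem lt_inner_of_mem_interior {E : Type*} [NormedAddCommGroup E] [InnerProductSpace ℝ E]
    {s : Set E} {x n : E} {a : ℝ} (hn : n ≠ 0) (hs : ∀ y ∈ s, a ≤ inner ℝ n y)
    (hx : x ∈ interior s) : a < inner ℝ n x := by
  have hl : IsOpenMap (innerSL ℝ n) := (innerSL ℝ n).isOpenMap_of_ne_zero fun h => hn (by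
    have := congrArg (fun l => l n) h
    simpa using this)
  have himg : innerSL ℝ n '' interior s ⊆ interior (Ici a) :=
    interior_maximal (image_subset_iff.2 fun y hy => hs y (interior_subset hy))
      (hl _ isOpen_interior)
  have := himg (mem_image_of_mem _ hx)
  rwa [interior_Ici] at this

/-- If the open ball of radius `r > 0` about a point `x` of `P` misses the frontier, connectedness
puts it in the interior; testing `x - s • N j` with `s` close to `r` gives the `j`-th inequality.
Conversely, a frontier point violates some strict inequality, and Cauchy–Schwarz with `‖N j‖ = 1`
bounds its distance from `x` below by `r`. -/
theorem rInterior_eq_polyhedron (hN : ∀ j, ‖N j‖ = 1)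
    (hP : P = polyhedron (fun j => innerSL ℝ (N j)) Finset.univ b) {r : ℝ} (hr : 0 ≤ r) :
    rInterior P r = polyhedron (fun j => innerSL ℝ (N j)) Finset.univ fun j => b j + r := by
  have hclosed : IsClosed P := hP ▸ isClosed_polyhedron _ _ _
  have hmem : ∀ x, x ∈ P ↔ ∀ j, b j ≤ inner ℝ (N j) x := fun x => by
    rw [hP]; simp [polyhedron]
  ext x
  have hpoly : x ∈ polyhedron (fun j => innerSL ℝ (N j)) Finset.univ (fun j => b j + r) ↔
      ∀ j, b j + r ≤ inner ℝ (N j) x := by simp [polyhedron]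
  rw [hpoly]
  constructor
  · rintro ⟨hxP, hx⟩ j
    rcases hr.eq_or_lt with rfl | hr
    · simpa using (hmem x).1 hxP j
    have hfr : ∀ z ∈ Metric.ball x r, z ∉ frontier P := fun z hz hzf => by
      have := hx z hzf
      rw [Metric.mem_ball, dist_comm] at hz
      linarith
    have hsub : Metric.ball x r ⊆ interior P := by
      refine IsPreconnected.subset_left_of_subset_union isOpen_interior hclosed.isOpen_compl
        (disjoint_compl_right.mono_left interior_subset) (fun z hz => ?_)
        ⟨x, Metric.mem_ball_self hr, ?_⟩ (convex_ball x r).isPreconnected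
      · by_cases hzP : z ∈ P
        · exact Or.inl (by_contra fun h => hfr z hz (hclosed.frontier_eq ▸ ⟨hzP, h⟩))
        · exact Or.inr hzP
      · exact by_contra fun h =>
          hfr x (Metric.mem_ball_self hr) (hclosed.frontier_eq ▸ ⟨hxP, h⟩)
    refine le_of_forall_lt_imp_le_of_dense fun a ha => ?_
    -- The step must be at least `a - b j`, below `r`, and nonnegative so that `s • N j` has norm
    -- `s`.
    let s : ℝ := max 0 (a - b j)
    have hs0 : 0 ≤ s := le_max_left _ _
    have hsr : s < r := max_lt hr (by linarith)
    have hball : x - s • N j ∈ Metric.ball x r := by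
      rw [Metric.mem_ball, dist_eq_norm, sub_sub_cancel_left, norm_neg, norm_smul, hN j, mul_one,
        Real.norm_of_nonneg hs0]
      exact hsr
    have := (hmem _).1 (interior_subset (hsub hball)) j
    rw [inner_sub_right, inner_smul_right, real_inner_self_eq_norm_sq, hN j] at this
    have hs : a - b j ≤ s := le_max_right _ _
    linarith
  · intro h
    refine ⟨(hmem x).2 fun j => by linarith [h j], fun y hy => ?_⟩
    rw [hclosed.frontier_eq] at hy
    obtain ⟨j, hj⟩ : ∃ j, inner ℝ (N j) y ≤ b j := by
      by_contra! hcon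
      refine hy.2 (interior_maximal (t := {z | ∀ j, b j < inner ℝ (N j) z})
        (fun z hz => (hmem z).2 fun j => (hz j).le) ?_ hcon)
      simp only [ofPred_forall]
      exact isOpen_iInter_of_finite fun j => isOpen_lt (by fun_prop) (by fun_prop)
    have h₁ : inner ℝ (N j) (x - y) ≤ ‖N j‖ * ‖x - y‖ := real_inner_le_norm _ _
    rw [inner_sub_right, hN j, one_mul, ← dist_eq_norm] at h₁
    linarith [h j]

/-- A homothety of small ratio `c > 0` centred at an interior point `p` of the bounded polyhedron
maps the polyhedron with support numbers `t` into it. -/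
theorem isBounded_polyhedron {ι E : Type} [Finite ι] [NormedAddCommGroup E] [InnerProductSpace ℝ E]
    {n : ι → E} (hn : ∀ i, n i ≠ 0) {A : Finset ι} {b : ι → ℝ}
    (hb : Bornology.IsBounded (polyhedron (fun i => innerSL ℝ (n i)) A b))
    (hint : (interior (polyhedron (fun i => innerSL ℝ (n i)) A b)).Nonempty) (t : ι → ℝ) :
    Bornology.IsBounded (polyhedron (fun i => innerSL ℝ (n i)) A t) := by
  obtain ⟨p, hp⟩ := hint
  have hlt : ∀ i ∈ A, b i < inner ℝ (n i) p := fun i hi =>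
    lt_inner_of_mem_interior (s := polyhedron (fun i => innerSL ℝ (n i)) A b) (hn i) (fun y hy => hy i hi) hp
  have hev : ∀ᶠ c in nhdsWithin (0 : ℝ) (Ioi 0), ∀ i ∈ A,
      b i < inner ℝ (n i) p + c * (t i - inner ℝ (n i) p) := by
    refine (Filter.eventually_all_finset A).2 fun i hi => nhdsWithin_le_nhds ?_
    have hc : ContinuousAt (fun c : ℝ => inner ℝ (n i) p + c * (t i - inner ℝ (n i) p)) 0 := by
      fun_prop
    exact hc.eventually (lt_mem_nhds (by simpa using hlt i hi))
  obtain ⟨c, hc, hc0⟩ := (hev.and self_mem_nhdsWithin).exists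
  have hc0 : 0 < c := hc0
  obtain ⟨C, hC⟩ := hb.exists_norm_le
  refine isBounded_iff_forall_norm_le.2 ⟨c⁻¹ * (C + ‖p‖) + ‖p‖, fun x hx => ?_⟩
  have hmem : p + c • (x - p) ∈ polyhedron (fun i => innerSL ℝ (n i)) A b := fun i hi => by
    have h₁ := hc i hi
    have h₂ : t i ≤ inner ℝ (n i) x := hx i hi
    rw [innerSL_apply_apply, inner_add_right, inner_smul_right, inner_sub_right]
    nlinarith
  have h₁ := hC _ hmem
  have h₂ : c • (x - p) = (p + c • (x - p)) - p := by abel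
  have h₃ : c * ‖x - p‖ ≤ C + ‖p‖ := by
    rw [← Real.norm_of_nonneg hc0.le, ← norm_smul, h₂]
    exact (norm_sub_le _ _).trans (by gcongr)
  have h₄ : ‖x - p‖ ≤ c⁻¹ * (C + ‖p‖) := by
    rw [inv_mul_eq_div, le_div_iff₀ hc0]
    linarith
  calc ‖x‖ = ‖(x - p) + p‖ := by rw [sub_add_cancel]
    _ ≤ ‖x - p‖ + ‖p‖ := norm_add_le _ _
    _ ≤ _ := by gcongr

theorem innerVolume_eq (hN : ∀ j, ‖N j‖ = 1)
    (hP : P = polyhedron (fun j => innerSL ℝ (N j)) Finset.univ b) (hb : Bornology.IsBounded P)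
    {r : ℝ} (hr : 0 ≤ r) :
    innerVolume P r = volume.real P -
      volume.real (polyhedron (fun j => innerSL ℝ (N j)) Finset.univ fun j => b j + r) := by
  have hsub : rInterior P r ⊆ P := fun x hx => hx.1
  rw [innerVolume, ← Measure.real, measureReal_sdiff hsub _ hb.measure_lt_top.ne,
    rInterior_eq_polyhedron hN hP hr]
  rw [rInterior_eq_polyhedron hN hP hr]
  exact (isClosed_polyhedron _ _ _).measurableSet

/-- Otherwise `n i` would be orthogonal to everything orthogonal to the other vectors, hence would
lie in their span, which equals its double orthogonal complement. -/
theorem LinearIndepOn.exists_dual_vector {E ι : Type*} [NormedAddCommGroup E] [InnerProductSpace ℝ E]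
    [FiniteDimensional ℝ E] {n : ι → E} {S : Set ι} (hS : LinearIndepOn ℝ n S) {i : ι}
    (hi : i ∈ S) : ∃ v, inner ℝ (n i) v ≠ 0 ∧ ∀ l ∈ S, l ≠ i → inner ℝ (n l) v = 0 := by
  by_contra! hcon
  refine linearIndepOn_iff_notMem_span.1 hS i hi ?_
  rw [← Submodule.orthogonal_orthogonal (Submodule.span ℝ (n '' (S \ {i}))),
    Submodule.mem_orthogonal']
  intro v hv
  by_contra h
  obtain ⟨l, hl, hli, hne⟩ := hcon v h
  exact hne ((Submodule.mem_orthogonal _ _).1 hv _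
    (Submodule.subset_span (mem_image_of_mem n ⟨hl, hli⟩)))

theorem contDiff_measureReal_polyhedron_add
    (hb : ∀ t, Bornology.IsBounded (polyhedron (fun j => innerSL ℝ (N j)) Finset.univ t)) (k : ℕ)
    (hk : ∀ S : Finset (Fin m), S.card ≤ k + 1 → LinearIndepOn ℝ N (S : Set (Fin m))) :
    ContDiff ℝ k fun r : ℝ =>
      volume.real (polyhedron (fun j => innerSL ℝ (N j)) Finset.univ fun j => b j + r) := by
  have := contDiff_measureReal_polyhedron k (volume : Measure (EuclideanSpace ℝ (Fin d))) hb
    fun S _ hcard i hi => (hk S hcard).exists_dual_vector hi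
  exact this.comp (contDiff_pi.2 fun j => by fun_prop)

theorem linearIndepOn_of_card_le_one (hN : ∀ j, ‖N j‖ = 1) {S : Finset (Fin m)}
    (hS : S.card ≤ 1) : LinearIndepOn ℝ N (S : Set (Fin m)) := by
  refine linearIndepOn_iff_notMem_span.2 fun i hi => ?_
  have : (S : Set (Fin m)) \ {i} = ∅ := by
    ext l
    simpa using fun hl => Finset.card_le_one.1 hS l hl i hi
  rw [this, image_empty, Submodule.span_empty, Submodule.mem_bot]
  intro h
  simpa [h] using hN i

theorem HasAbsoluteRank.linearIndepOn_of_card_le {k : ℕ} (hk : HasAbsoluteRank N k)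
    (hN : ∀ j, ‖N j‖ = 1) {S : Finset (Fin m)} (hS : S.card ≤ k - 1 + 1) :
    LinearIndepOn ℝ N (S : Set (Fin m)) := by
  -- Truncated subtraction: for `k = 0` the bound `k - 1 + 1` is `1`, which unit norms cover; for `k
  -- ≥ 1` it is `k`.
  rcases Nat.eq_zero_or_pos k with rfl | hpos
  · exact linearIndepOn_of_card_le_one hN hS
  rcases hk with ⟨-, rfl⟩ | ⟨hind, s, hs, -⟩
  · exact absurd hpos (lt_irrefl 0)
  -- The dependent set of `k + 1` members guarantees `m ≥ k + 1`, so a smaller set extends to one of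
  -- exactly `k` members.
  · have hm := Finset.card_le_univ s
    obtain ⟨T, hST, hT⟩ := Finset.exists_superset_card_eq (s := S) (n := k) (by omega) (by omega)
    exact (hind T hT).mono (by exact_mod_cast hST)

/-- The parameter `r` enters the inequalities affinely, so it can be treated as one more coordinate.
For `r ≥ 0` all the polyhedra shrink inside the one for `b`, so a single box contains them. -/
theorem exists_isPiecewisePoly_measureReal_polyhedron (N : Fin m → EuclideanSpace ℝ (Fin d))
    (b : Fin m → ℝ)
    (hb : Bornology.IsBounded (polyhedron (fun j => innerSL ℝ (N j)) Finset.univ b)) :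
    ∃ f : ℝ → ℝ, IsPiecewisePoly d f ∧ ∀ r, 0 ≤ r →
      volume.real (polyhedron (fun j => innerSL ℝ (N j)) Finset.univ fun j => b j + r) = f r := by
  obtain ⟨C, hC⟩ := hb.exists_norm_le
  let M : ℝ := max C 0
  let toL : (Fin d → ℝ) →ₗ[ℝ] EuclideanSpace ℝ (Fin d) :=
    (WithLp.linearEquiv 2 ℝ (Fin d → ℝ)).symm.toLinearMap
  let l : Fin m → ℝ × (Fin d → ℝ) →ᵃ[ℝ] ℝ := fun j =>
    (((innerSL ℝ (N j)).toLinearMap ∘ₗ toL ∘ₗ LinearMap.snd ℝ ℝ (Fin d → ℝ)).toAffineMap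
      - (LinearMap.fst ℝ ℝ (Fin d → ℝ)).toAffineMap) - AffineMap.const ℝ _ (b j)
  have hl : ∀ j r y, l j (r, y) = inner ℝ (N j) (toL y) - r - b j := fun j r y => rfl
  have hpoly := (IsPiecewisePoly.indicator_of_forall l).setIntegral_pi_Icc (le_max_right C 0)
  rw [zero_add] at hpoly
  refine ⟨_, hpoly, fun r hr => ?_⟩
  let Q := polyhedron (fun j => innerSL ℝ (N j)) Finset.univ fun j => b j + r
  have hQ : MeasurableSet Q := (isClosed_polyhedron _ _ _).measurableSet
  have hpre : (toL ⁻¹' Q) = {y | ∀ j, 0 ≤ l j (r, y)} := by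
    ext y
    simp only [Q, polyhedron, mem_preimage, mem_ofPred_eq, Finset.mem_univ, forall_true_left, hl,
      innerSL_apply_apply]
    exact forall_congr' fun j => by constructor <;> intro h <;> linarith
  have htoL : MeasurePreserving toL volume volume := PiLp.volume_preserving_toLp (Fin d)
  have hbox : toL ⁻¹' Q ⊆ univ.pi fun _ => Icc (-M) M := by
    intro y hy i _
    have h₁ : ‖toL y‖ ≤ C := hC _ fun j hj => by
      have := hy j hj
      linarith
    have h₂ : ‖y i‖ ≤ ‖toL y‖ := PiLp.norm_apply_le (toL y) i
    have h₃ : C ≤ M := le_max_left _ _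
    exact abs_le.1 (h₂.trans (h₁.trans h₃))
  rw [← htoL.measureReal_preimage hQ.nullMeasurableSet]
  have hind : ∀ y, ({p : ℝ × (Fin d → ℝ) | ∀ j, 0 ≤ l j p}.indicator (fun _ => (1 : ℝ))) (r, y)
      = (toL ⁻¹' Q).indicator 1 y := fun y => by
    rw [hpre]
    rfl
  simp only [hind]
  have hmeas : MeasurableSet (toL ⁻¹' Q) := htoL.measurable hQ
  rw [integral_indicator_one hmeas, measureReal_restrict_apply hmeas, inter_eq_left.2 hbox]

theorem exists_measureReal_polyhedron_eventually_const (N : Fin m → EuclideanSpace ℝ (Fin d))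
    (b : Fin m → ℝ)
    (hb : Bornology.IsBounded (polyhedron (fun j => innerSL ℝ (N j)) Finset.univ b)) :
    ∃ R c : ℝ, 0 < R ∧ ∀ r, R ≤ r →
      volume.real (polyhedron (fun j => innerSL ℝ (N j)) Finset.univ fun j => b j + r) = c := by
  -- With no half-spaces the polyhedron is the whole space for every `r`; otherwise a single
  -- half-space, pushed far enough, misses the bounded set and the volume becomes `0`.
  rcases isEmpty_or_nonempty (Fin m) with hm | ⟨⟨j⟩⟩
  · exact ⟨1, volume.real (univ : Set (EuclideanSpace ℝ (Fin d))), one_pos, fun r _ => by simp [polyhedron]⟩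
  obtain ⟨C, hC⟩ := hb.exists_norm_le
  refine ⟨max 1 (‖N j‖ * C - b j + 1), 0, lt_max_of_lt_left one_pos, fun r hr => ?_⟩
  have hr₁ : 1 ≤ r := (le_max_left _ _).trans hr
  have hr₂ := (le_max_right _ _).trans hr
  convert measureReal_empty
  refine eq_empty_of_forall_notMem fun x hx => ?_
  have h₁ : ‖x‖ ≤ C := hC x fun i hi => by linarith [hx i hi]
  have h₂ : b j + r ≤ inner ℝ (N j) x := hx j (Finset.mem_univ j)
  have h₃ := real_inner_le_norm (N j) x
  have h₄ := mul_le_mul_of_nonneg_left h₁ (norm_nonneg (N j))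
  linarith

end HalfSpaces

theorem mainTheorem1 (d : ℕ) (P : Set (EuclideanSpace ℝ (Fin d))) (hP : IsPolytope P) :
    IsPluriphaseSteinerLike d (innerVolume P) ∧
      ∀ (m : ℕ) (N : Fin m → EuclideanSpace ℝ (Fin d)) (b : Fin m → ℝ),
        IsMinimalHalfSpaceFamily P N b →
          ∀ k : ℕ, HasAbsoluteRank N k →
            ContDiffOn ℝ ((k - 1 : ℕ) : WithTop ℕ∞) (innerVolume P) (Set.Ici 0) := by
  have hbd := hP.isCompact.isBounded
  -- Stated for an arbitrary presentation with unit normals, so that `k = 0` also supplies the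
  -- continuity required in the first claim.
  have smooth : ∀ (m : ℕ) (N : Fin m → EuclideanSpace ℝ (Fin d)) (b : Fin m → ℝ),
      (∀ j, ‖N j‖ = 1) → P = polyhedron (fun j => innerSL ℝ (N j)) Finset.univ b → ∀ k : ℕ,
      (∀ S : Finset (Fin m), S.card ≤ k + 1 → LinearIndepOn ℝ N (S : Set (Fin m))) →
      ContDiffOn ℝ k (innerVolume P) (Ici 0) := by
    intro m N b hN hPN k hk
    have hne : ∀ j, N j ≠ 0 := fun j h => by simpa [h] using hN j
    have hb : ∀ t, Bornology.IsBounded (polyhedron (fun j => innerSL ℝ (N j)) Finset.univ t) :=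
      isBounded_polyhedron hne (hPN ▸ hbd) (hPN ▸ hP.interior_nonempty)
    exact (contDiff_const.sub (contDiff_measureReal_polyhedron_add hb k hk)).contDiffOn.congr
      fun r hr => innerVolume_eq hN hPN hbd hr
  refine ⟨?_, fun m N b hNb k hk => smooth m N b hNb.norm_eq_one
    (hNb.eq_iInter.trans (iInter_closedHalfSpace N b)) (k - 1) fun S hS =>
      hk.linearIndepOn_of_card_le hNb.norm_eq_one hS⟩
  obtain ⟨m, N, b, hN, hPN⟩ := hP.exists_halfSpaces
  rw [iInter_closedHalfSpace] at hPN
  obtain ⟨f, hf, hfeq⟩ := exists_isPiecewisePoly_measureReal_polyhedron N b (hPN ▸ hbd)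
  obtain ⟨R, c, hR, hc⟩ := exists_measureReal_polyhedron_eventually_const N b (hPN ▸ hbd)
  refine (((IsPiecewisePoly.const (volume.real P)).mono (Nat.zero_le d)).sub
    hf).isPluriphaseSteinerLike (fun r hr => ?_)
    (smooth m N b hN hPN 0 fun S hS => linearIndepOn_of_card_le_one hN hS).continuousOn
    (fun r _ => ENNReal.toReal_nonneg) hR (c := volume.real P - c) fun r hr => ?_
  · rw [innerVolume_eq hN hPN hbd hr, hfeq r hr]
  · rw [innerVolume_eq hN hPN hbd (hR.le.trans hr), hc r hr]
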